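/- Let $m, d, s$ be non-negative integers with $m \ge 4s+1$. Identify a pair $(A,b)$, where $A \in \mathbb{C}^{m\times d}$ has rows $a_1,\dots,a_m \in \mathbb{C}^d$ and $b=(b_1,\dots,b_m)^\top \in \mathbb{C}^m$, with the matrix in $\mathbb{C}^{m\times(d+1)}$ whose first $d$ columns form $A$ and whose last column is $b$. Put $\langle a, x\rangle = \sum_{i=1}^d a_i \overline{x_i}$ and $$M_{A,b}(x) = \bigl(|\langle a_1,x\rangle + b_1|,\dots,|\langle a_m,x\rangle + b_m|\bigr), \qquad x \in \mathbb{C}^d.$$ Call $(A,b)$ $s$-sparse affine phase retrievable for $\mathbb{C}^d$ if $M_{A,b}$ is injective on the set $\Sigma_s(\mathbb{C}^d)$ of all $x \in \mathbb{C}^d$ with at most $s$ nonzero entries. Then a generic $(A,b) \in \mathbb{C}^{m\times(d+1)}$ is $s$-sparse affine phase retrievable for $\mathbb{C}^d$; that is, there is a dense open set $X \subset \mathbb{C}^{m\times(d+1)}$ whose complement has Lebesgue measure zero such that every $(A,b) \in X$ is $s$-sparse affine phase retrievable for $\mathbb{C}^d$. -/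

import Mathlib

open MeasureTheory Matrix

/-- The affine measurement map `M_{A,b}(x) = (|⟨a₁, x⟩ + b₁|, …, |⟨aₘ, x⟩ + bₘ|)` on `ℂᵈ`, where `aⱼ`
is the `j`-th row of `A` and `⟨a, x⟩ = ∑ i, a i * conj (x i)`. -/
noncomputable def affineMagnitudes {m d : ℕ} (A : Matrix (Fin m) (Fin d) ℂ) (b : Fin m → ℂ)
    (x : Fin d → ℂ) : Fin m → ℝ :=
  fun j => ‖(A j ⬝ᵥ star x) + b j‖

/-- `Σ_s(ℂᵈ)`: the vectors with at most `s` nonzero entries. -/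
def sparseVectors (s d : ℕ) : Set (Fin d → ℂ) :=
  {x | hammingNorm x ≤ s}

/-- `(A, b)` is `s`-sparse affine phase retrievable for `ℂᵈ`. -/
def IsSparseAffinePhaseRetrievable {m d : ℕ} (s : ℕ) (A : Matrix (Fin m) (Fin d) ℂ)
    (b : Fin m → ℂ) : Prop :=
  Set.InjOn (affineMagnitudes A b) (sparseVectors s d)

/-- A generic element of `ℂᴺ` (coordinates indexed by a finite type) satisfies `P`: the property `P`
holds at every point of some dense open set whose complement is Lebesgue-null. -/
def HoldsGenerically {ι : Type*} [Fintype ι] (P : (ι → ℂ) → Prop) : Prop :=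
  ∃ X : Set (ι → ℂ), IsOpen X ∧ Dense X ∧ volume Xᶜ = 0 ∧ ∀ u ∈ X, P u

/-- The first `d` columns of an element of `ℂ^{m × (d+1)}`. -/
def linearPart {m d : ℕ} (u : Fin m × Fin (d + 1) → ℂ) : Matrix (Fin m) (Fin d) ℂ :=
  Matrix.of fun j i => u (j, i.castSucc)

/-- The last column of an element of `ℂ^{m × (d+1)}`. -/
def shiftPart {m d : ℕ} (u : Fin m × Fin (d + 1) → ℂ) : Fin m → ℂ :=
  fun j => u (j, Fin.last d)

/-!
The pairs `(A, b)` that fail to be retrievable are those with a collision: distinct `s`-sparse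
vectors `x`, `y` such that `|⟨aⱼ, x⟩ + bⱼ| = |⟨aⱼ, y⟩ + bⱼ|` for every row `j`. The proof counts real
dimensions. On supports `I`, `J` of size at most `s`, the vectors `x` and `y` have at most `4s` real
parameters, and given `x ≠ y` each row of `(A, b)` satisfies one real equation, which leaves it
`2d + 1` real parameters. The total `4s + m (2d + 1)` is less than `2m (d + 1)` because `m ≥ 4s + 1`.

The equation can be solved polynomially. If `⟨a, x - y⟩ ≠ 0`, it says that the quotient of
`⟨a, x + y⟩ + 2b` by `⟨a, x - y⟩` is purely imaginary, so `b` is a polynomial in `x`, `y`, `a` and a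
real parameter. If `⟨a, x - y⟩ = 0`, then `b` is free and `a` lies in a hyperplane, which is
parametrized using an entry where `x` and `y` differ. Choosing the supports, that entry and the set
of rows of the second kind, the pairs with a collision are covered by the images of finitely many
real polynomial maps (`exists_mem_range_collisionMap`).

The image of a polynomial map between real vector spaces that raises the dimension lies in the zero
set of a nonzero polynomial, as the coordinates of the map are algebraically dependent
(`exists_relation_of_finrank_lt_card`). Such a zero set is closed and Lebesgue-null, so its
complement is open and dense; passing to polynomial relations is what yields an open set although
the set of collisions need not be closed.
-/

/-! ### Zero sets of real polynomials are null -/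

/-- Induction on the number of variables: regarded as a polynomial in its first variable, `P` has a
nonzero coefficient, which vanishes only on a null set; off that set the slice is finite. -/
theorem MvPolynomial.volume_zeros_eq_zero {n : ℕ} {P : MvPolynomial (Fin n) ℝ} (hP : P ≠ 0) :
    volume {x : Fin n → ℝ | MvPolynomial.eval x P = 0} = 0 := by
  induction n with
  | zero =>
    have h : {x : Fin 0 → ℝ | MvPolynomial.eval x P = 0} = ∅ := by
      refine Set.eq_empty_of_forall_notMem fun x hx => hP ?_
      refine MvPolynomial.funext fun y => ?_
      rw [Subsingleton.elim y x, map_zero]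
      exact hx
    rw [h, measure_empty]
  | succ n ih =>
    have hclosed : IsClosed {x : Fin (n + 1) → ℝ | MvPolynomial.eval x P = 0} :=
      isClosed_eq (MvPolynomial.continuous_eval P) continuous_const
    have hQ : MvPolynomial.finSuccEquiv ℝ n P ≠ 0 := by simpa using hP
    obtain ⟨k, hk⟩ : ∃ k, (MvPolynomial.finSuccEquiv ℝ n P).coeff k ≠ 0 := by
      by_contra! h
      exact hQ (Polynomial.ext fun k => by simpa using h k)
    have e := (volume_preserving_piFinSuccAbove (fun _ : Fin (n + 1) => ℝ) 0).symm
    rw [← e.measure_preimage hclosed.measurableSet.nullMeasurableSet,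
      Measure.volume_eq_prod, Measure.prod_apply_symm (e.measurable hclosed.measurableSet),
      lintegral_eq_zero_iff' (measurable_measure_prodMk_right
        (e.measurable hclosed.measurableSet)).aemeasurable]
    have hae : ∀ᵐ s : Fin n → ℝ,
        MvPolynomial.eval s ((MvPolynomial.finSuccEquiv ℝ n P).coeff k) ≠ 0 := by
      rw [ae_iff]
      simpa using ih hk
    filter_upwards [hae] with s hs
    have hne : (MvPolynomial.finSuccEquiv ℝ n P).map (MvPolynomial.eval s) ≠ 0 := by
      intro h
      apply hs
      rw [← Polynomial.coeff_map, h, Polynomial.coeff_zero]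
    refine Set.Finite.measure_zero ((Polynomial.finite_setOfPred_isRoot hne).subset fun t ht => ?_) _
    have ht' : MvPolynomial.eval (Fin.cons t s : Fin (n + 1) → ℝ) P = 0 := by
      rw [← Fin.insertNth_zero']
      exact ht
    rwa [MvPolynomial.eval_eq_eval_mv_eval'] at ht'

theorem addHaar_polynomial_zeros_eq_zero {E κ : Type*} [Fintype κ] [NormedAddCommGroup E]
    [NormedSpace ℝ E] [FiniteDimensional ℝ E] [MeasurableSpace E] [BorelSpace E] (μ : Measure E)
    [μ.IsAddHaarMeasure] (B : Module.Basis κ ℝ E) {P : MvPolynomial κ ℝ} (hP : P ≠ 0) :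
    μ {u | MvPolynomial.eval (B.repr u) P = 0} = 0 := by
  let e := Fintype.equivFin κ
  let L : E ≃L[ℝ] (Fin (Fintype.card κ) → ℝ) := (B.reindex e).equivFun.toContinuousLinearEquiv
  have hQ : MvPolynomial.rename e P ≠ 0 := fun h =>
    hP (MvPolynomial.rename_injective e e.injective (by rw [h, map_zero]))
  have hclosed : IsClosed {x : Fin (Fintype.card κ) → ℝ |
      MvPolynomial.eval x (MvPolynomial.rename e P) = 0} :=
    isClosed_eq (MvPolynomial.continuous_eval _) continuous_const
  have hnull : μ.map L {x | MvPolynomial.eval x (MvPolynomial.rename e P) = 0} = 0 :=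
    Measure.absolutelyContinuous_isAddHaarMeasure (μ.map L) volume
      (MvPolynomial.volume_zeros_eq_zero hQ)
  rw [Measure.map_apply L.continuous.measurable hclosed.measurableSet] at hnull
  convert hnull using 2
  ext u
  have : (L u : Fin (Fintype.card κ) → ℝ) ∘ e = B.repr u := by
    ext k
    simp [L]
  simp [MvPolynomial.eval_rename, this]

/-! ### Polynomial maps on a real vector space -/

/-- The algebra of polynomial functions `V → ℝ`: those generated by the linear functionals. -/
def realPolynomialFunctions (V : Type*) [AddCommGroup V] [Module ℝ V] : Subalgebra ℝ (V → ℝ) :=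
  Algebra.adjoin ℝ (Set.range fun (l : V →ₗ[ℝ] ℝ) (v : V) => l v)

section PolynomialFunctions

variable {V : Type*} [AddCommGroup V] [Module ℝ V]

theorem exists_mvPolynomial_of_mem_realPolynomialFunctions {κ : Type*} [Finite κ]
    (B : Module.Basis κ ℝ V) {f : V → ℝ} (hf : f ∈ realPolynomialFunctions V) :
    ∃ p : MvPolynomial κ ℝ, ∀ v, f v = MvPolynomial.eval (B.repr v) p := by
  have := Fintype.ofFinite κ
  refine Algebra.adjoin_induction (p := fun f _ =>
    ∃ p : MvPolynomial κ ℝ, ∀ v, f v = MvPolynomial.eval (B.repr v) p) ?_ ?_ ?_ ?_ hf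
  · rintro _ ⟨l, rfl⟩
    refine ⟨∑ k, MvPolynomial.C (l (B k)) * MvPolynomial.X k, fun v => ?_⟩
    have h := congrArg l (B.sum_repr v)
    rw [map_sum] at h
    simp [← h, mul_comm]
  · exact fun r => ⟨MvPolynomial.C r, fun v => by simp⟩
  · rintro f g - - ⟨p, hp⟩ ⟨q, hq⟩
    exact ⟨p + q, fun v => by simp [hp, hq]⟩
  · rintro f g - - ⟨p, hp⟩ ⟨q, hq⟩
    exact ⟨p * q, fun v => by simp [hp, hq]⟩

/-- More polynomial functions than variables satisfy a polynomial relation, since the polynomial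
ring in `n` variables has transcendence degree `n`. -/
theorem exists_relation_of_finrank_lt_card [FiniteDimensional ℝ V] {κ : Type*} [Fintype κ]
    {f : κ → V → ℝ} (hf : ∀ k, f k ∈ realPolynomialFunctions V)
    (hcard : Module.finrank ℝ V < Fintype.card κ) :
    ∃ P : MvPolynomial κ ℝ, P ≠ 0 ∧ ∀ v, MvPolynomial.eval (fun k => f k v) P = 0 := by
  let B := Module.finBasis ℝ V
  choose p hp using fun k => exists_mvPolynomial_of_mem_realPolynomialFunctions B (hf k)
  have hdep : ¬ AlgebraicIndependent ℝ p := by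
    intro h
    have hle := h.lift_cardinalMk_le_trdeg
    rw [MvPolynomial.trdeg_of_isDomain] at hle
    simp only [Cardinal.mk_fintype, Cardinal.lift_natCast, Fintype.card_fin, Nat.cast_le] at hle
    omega
  rw [algebraicIndependent_iff] at hdep
  push Not at hdep
  obtain ⟨P, hP, hne⟩ := hdep
  refine ⟨P, hne, fun v => ?_⟩
  have h := congrArg (MvPolynomial.eval (B.repr v)) hP
  rw [map_zero] at h
  simp only [hp]
  exact (MvPolynomial.eval₂Hom_bind₁ (RingHom.id ℝ) _ p P).symm.trans h

/-- A complex-valued function on a real vector space whose real and imaginary parts are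
polynomial. -/
def IsPolynomialFunction (g : V → ℂ) : Prop :=
  (fun v => (g v).re) ∈ realPolynomialFunctions V ∧ (fun v => (g v).im) ∈ realPolynomialFunctions V

namespace IsPolynomialFunction

theorem linear (l : V →ₗ[ℝ] ℂ) : IsPolynomialFunction fun v => l v :=
  ⟨Algebra.subset_adjoin ⟨Complex.reLm ∘ₗ l, rfl⟩, Algebra.subset_adjoin ⟨Complex.imLm ∘ₗ l, rfl⟩⟩

theorem const (c : ℂ) : IsPolynomialFunction fun _ : V => c :=
  ⟨(realPolynomialFunctions V).algebraMap_mem c.re, (realPolynomialFunctions V).algebraMap_mem c.im⟩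

variable {f g : V → ℂ}

theorem add (hf : IsPolynomialFunction f) (hg : IsPolynomialFunction g) :
    IsPolynomialFunction fun v => f v + g v :=
  ⟨add_mem hf.1 hg.1, add_mem hf.2 hg.2⟩

theorem sub (hf : IsPolynomialFunction f) (hg : IsPolynomialFunction g) :
    IsPolynomialFunction fun v => f v - g v :=
  ⟨sub_mem hf.1 hg.1, sub_mem hf.2 hg.2⟩

theorem neg (hf : IsPolynomialFunction f) : IsPolynomialFunction fun v => -f v :=
  ⟨neg_mem hf.1, neg_mem hf.2⟩

theorem mul (hf : IsPolynomialFunction f) (hg : IsPolynomialFunction g) :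
    IsPolynomialFunction fun v => f v * g v :=
  ⟨sub_mem (mul_mem hf.1 hg.1) (mul_mem hf.2 hg.2), add_mem (mul_mem hf.1 hg.2) (mul_mem hf.2 hg.1)⟩

theorem star (hf : IsPolynomialFunction f) : IsPolynomialFunction fun v => Star.star (f v) :=
  ⟨hf.1, neg_mem hf.2⟩

theorem sum {ι : Type*} {f : ι → V → ℂ} (t : Finset ι) (hf : ∀ i ∈ t, IsPolynomialFunction (f i)) :
    IsPolynomialFunction fun v => ∑ i ∈ t, f i v := by
  constructor
  · simp only [Complex.re_sum]
    simpa only [Finset.sum_fn] using sum_mem fun i hi => (hf i hi).1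
  · simp only [Complex.im_sum]
    simpa only [Finset.sum_fn] using sum_mem fun i hi => (hf i hi).2

end IsPolynomialFunction

end PolynomialFunctions

/-! ### Generic properties -/

theorem HoldsGenerically.mono {ι : Type*} [Fintype ι] {P Q : (ι → ℂ) → Prop}
    (hP : HoldsGenerically P) (h : ∀ u, P u → Q u) : HoldsGenerically Q := by
  obtain ⟨X, ho, hd, hn, hX⟩ := hP
  exact ⟨X, ho, hd, hn, fun u hu => h u (hX u hu)⟩

/-- Density need not be checked: a set with null complement is dense. -/
theorem holdsGenerically_of_isOpen_of_null {ι : Type*} [Fintype ι] {P : (ι → ℂ) → Prop}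
    {X : Set (ι → ℂ)} (ho : IsOpen X) (hn : volume Xᶜ = 0) (hX : ∀ u ∈ X, P u) :
    HoldsGenerically P :=
  ⟨X, ho, Measure.dense_of_ae (μ := volume) (p := (· ∈ X)) (mem_ae_iff.2 hn), hn, hX⟩

theorem holdsGenerically_forall {ι τ : Type*} [Fintype ι] [Finite τ] {P : τ → (ι → ℂ) → Prop}
    (hP : ∀ t, HoldsGenerically (P t)) : HoldsGenerically fun u => ∀ t, P t u := by
  choose X ho _ hn hX using hP
  refine holdsGenerically_of_isOpen_of_null (X := ⋂ t, X t) (isOpen_iInter_of_finite ho) ?_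
    fun u hu t => hX t u (Set.mem_iInter.1 hu t)
  rw [Set.compl_iInter]
  exact measure_iUnion_null hn

/-- A generic point avoids the image of a polynomial map from a space of smaller real dimension:
the image lies in the zero set of a nonzero real polynomial, which is closed and null. -/
theorem holdsGenerically_notMem_range {ι V : Type*} [Fintype ι] [AddCommGroup V] [Module ℝ V]
    [FiniteDimensional ℝ V] {F : V → ι → ℂ} (hF : ∀ i, IsPolynomialFunction fun v => F v i)
    (hdim : Module.finrank ℝ V < 2 * Fintype.card ι) :
    HoldsGenerically fun u => u ∉ Set.range F := by
  let B : Module.Basis (Σ _ : ι, Fin 2) ℝ (ι → ℂ) := Pi.basis fun _ => Complex.basisOneI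
  have hcoord : ∀ k, (fun v => B.repr (F v) k) ∈ realPolynomialFunctions V := by
    rintro ⟨i, k⟩
    fin_cases k
    · simpa [B, Pi.basis_repr] using (hF i).1
    · simpa [B, Pi.basis_repr] using (hF i).2
  obtain ⟨P, hP, hz⟩ := exists_relation_of_finrank_lt_card hcoord (by
    simpa [mul_comm] using hdim)
  refine holdsGenerically_of_isOpen_of_null (X := {u | MvPolynomial.eval (B.repr u) P = 0}ᶜ) ?_ ?_ ?_
  · refine (isClosed_eq ?_ continuous_const).isOpen_compl
    have hB : Continuous fun u => (B.repr u : (Σ _ : ι, Fin 2) → ℝ) :=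
      LinearMap.continuous_of_finiteDimensional B.equivFun.toLinearMap
    exact (MvPolynomial.continuous_eval P).comp hB
  · rw [compl_compl]
    exact addHaar_polynomial_zeros_eq_zero volume B hP
  · rintro _ hu ⟨v, rfl⟩
    exact hu (hz v)

/-! ### Parametrizing the pairs with a collision -/

/-- The vector of `ℂᵈ` with entries `ξ` on `I` and zero entries elsewhere. -/
def extendByZero {d : ℕ} (I : Finset (Fin d)) (ξ : I → ℂ) : Fin d → ℂ :=
  fun i => if h : i ∈ I then ξ ⟨i, h⟩ else 0

theorem exists_extendByZero_of_mem_sparseVectors {s d : ℕ} {x : Fin d → ℂ}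
    (hx : x ∈ sparseVectors s d) :
    ∃ I : Finset (Fin d), I.card ≤ s ∧ ∃ ξ : I → ℂ, extendByZero I ξ = x := by
  classical
  refine ⟨Finset.univ.filter fun i => x i ≠ 0, hx, fun i => x i, ?_⟩
  ext i
  simp only [extendByZero, Finset.mem_filter, Finset.mem_univ, true_and]
  split_ifs with h
  · rfl
  · exact (not_not.1 h).symm

theorem isPolynomialFunction_extendByZero {V : Type*} [AddCommGroup V] [Module ℝ V] {d : ℕ}
    {I : Finset (Fin d)} (l : V →ₗ[ℝ] (I → ℂ)) (i : Fin d) :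
    IsPolynomialFunction fun v => extendByZero I (l v) i := by
  by_cases h : i ∈ I
  · simpa [extendByZero, h] using IsPolynomialFunction.linear (LinearMap.proj ⟨i, h⟩ ∘ₗ l)
  · simpa [extendByZero, h] using IsPolynomialFunction.const 0

/-- The space of parameters for a collision `M_{A,b}(x) = M_{A,b}(y)` with `x` supported in `I` and
`y` supported in `J`: the entries of `x` and `y` on these supports, and `2d + 1` real parameters for
each row of `(A, b)`. -/
abbrev CollisionParameters (m : ℕ) {d : ℕ} (I J : Finset (Fin d)) : Type :=
  ((I → ℂ) × (J → ℂ)) × (Fin m → (Fin d → ℂ) × ℝ)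

theorem finrank_collisionParameters (m : ℕ) {d : ℕ} (I J : Finset (Fin d)) :
    Module.finrank ℝ (CollisionParameters m I J) =
      2 * I.card + 2 * J.card + m * (2 * d + 1) := by
  simp [CollisionParameters, Module.finrank_prod, Module.finrank_pi_fintype,
    Complex.finrank_real_complex, mul_comm]

/-- A row `(a, b)` with `|⟨a, x⟩ + b| = |⟨a, y⟩ + b|` and `⟨a, x - y⟩ ≠ 0`: here `a` is free, and
`⟨a, x + y⟩ + 2b` is `r` times `i⟨a, x - y⟩`. -/
noncomputable def transverseRow {d : ℕ} (x y a : Fin d → ℂ) (r : ℝ) : Fin (d + 1) → ℂ :=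
  Fin.snoc (α := fun _ => ℂ) a
    ((r * Complex.I * (a ⬝ᵥ star (x - y)) - a ⬝ᵥ star (x + y)) * (1 / 2))

/-- A row `(a, b)` with `⟨a, x - y⟩ = 0`, where `x` and `y` differ in the entry `i₀`. The shift `b`
is the free parameter `p i₀`, and the other entries of `p` parametrize the solutions `a`; they are
scaled by the conjugate of `x i₀ - y i₀` so that no division occurs. -/
def orthogonalRow {d : ℕ} (i₀ : Fin d) (x y p : Fin d → ℂ) : Fin (d + 1) → ℂ :=
  Fin.snoc (α := fun _ => ℂ)
    (fun i => if i = i₀ then -∑ k ∈ Finset.univ.erase i₀, p k * star (x k - y k)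
      else p i * star (x i₀ - y i₀))
    (p i₀)

theorem exists_transverseRow {d : ℕ} {x y a : Fin d → ℂ} {b : ℂ}
    (h : ‖a ⬝ᵥ star x + b‖ = ‖a ⬝ᵥ star y + b‖) (hne : a ⬝ᵥ star (x - y) ≠ 0) :
    ∃ r : ℝ, transverseRow x y a r = Fin.snoc (α := fun _ => ℂ) a b := by
  set α := a ⬝ᵥ star x + b with hα
  set β := a ⬝ᵥ star y + b with hβ
  have hsub : a ⬝ᵥ star (x - y) = α - β := by
    rw [star_sub, dotProduct_sub, hα, hβ]; ring
  have hadd : a ⬝ᵥ star (x + y) = α + β - 2 * b := by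
    rw [star_add, dotProduct_add, hα, hβ]; ring
  rw [hsub] at hne
  -- As `|α| = |β|`, the quotient `(α + β) / (α - β)` is purely imaginary.
  have hre : ((α + β) / (α - β)).re = 0 := by
    have h2 : Complex.normSq α = Complex.normSq β := by
      rw [Complex.normSq_eq_norm_sq, Complex.normSq_eq_norm_sq, h]
    rw [Complex.normSq_apply, Complex.normSq_apply] at h2
    rw [Complex.div_re, ← add_div]
    refine div_eq_zero_iff.2 (Or.inl ?_)
    simp only [Complex.add_re, Complex.sub_re, Complex.add_im, Complex.sub_im]
    linarith
  have hq : ((((α + β) / (α - β)).im : ℝ) : ℂ) * Complex.I = (α + β) / (α - β) := by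
    apply Complex.ext <;> simp [hre]
  refine ⟨((α + β) / (α - β)).im, ?_⟩
  rw [transverseRow, hsub, hadd, hq, div_mul_cancel₀ _ hne]
  congr 1
  ring

theorem exists_orthogonalRow {d : ℕ} {i₀ : Fin d} {x y a : Fin d → ℂ} (b : ℂ) (hi : x i₀ ≠ y i₀)
    (h : a ⬝ᵥ star (x - y) = 0) :
    ∃ p : Fin d → ℂ, orthogonalRow i₀ x y p = Fin.snoc (α := fun _ => ℂ) a b := by
  have hne : star (x i₀ - y i₀) ≠ 0 := star_ne_zero.2 (sub_ne_zero.2 hi)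
  refine ⟨fun i => if i = i₀ then b else a i / star (x i₀ - y i₀), ?_⟩
  rw [orthogonalRow, if_pos rfl]
  congr 1
  ext i
  split_ifs with hii
  · subst hii
    rw [dotProduct, ← Finset.add_sum_erase _ _ (Finset.mem_univ i)] at h
    have hsum : ∀ k ∈ Finset.univ.erase i,
        (if k = i then b else a k / star (x i - y i)) * star (x k - y k) =
          a k * star (x - y) k / star (x i - y i) := by
      intro k hk
      rw [if_neg (Finset.ne_of_mem_erase hk), Pi.star_apply, Pi.sub_apply]
      ring
    rw [Finset.sum_congr rfl hsum, ← Finset.sum_div, ← neg_div, div_eq_iff hne,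
      ← eq_neg_of_add_eq_zero_left h, Pi.star_apply, Pi.sub_apply]
  · exact div_mul_cancel₀ _ hne

open Classical in
/-- The pair `(A, b)` with a collision determined by the parameters, where `S` is the set of the
rows of `A` that are orthogonal to `x - y`. -/
noncomputable def collisionMap {m d : ℕ} (I J : Finset (Fin d)) (i₀ : Fin d) (S : Set (Fin m))
    (v : CollisionParameters m I J) : Fin m × Fin (d + 1) → ℂ :=
  fun k => if k.1 ∈ S
    then orthogonalRow i₀ (extendByZero I v.1.1) (extendByZero J v.1.2) (v.2 k.1).1 k.2
    else transverseRow (extendByZero I v.1.1) (extendByZero J v.1.2) (v.2 k.1).1 (v.2 k.1).2 k.2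

theorem isPolynomialFunction_collisionMap {m d : ℕ} (I J : Finset (Fin d)) (i₀ : Fin d)
    (S : Set (Fin m)) (k : Fin m × Fin (d + 1)) :
    IsPolynomialFunction fun v => collisionMap I J i₀ S v k := by
  obtain ⟨j, c⟩ := k
  let l := LinearMap.fst ℝ ((I → ℂ) × (J → ℂ)) (Fin m → (Fin d → ℂ) × ℝ)
  let row : CollisionParameters m I J →ₗ[ℝ] (Fin d → ℂ) × ℝ :=
    LinearMap.proj j ∘ₗ LinearMap.snd ℝ _ _
  have hx (i) : IsPolynomialFunction fun v : CollisionParameters m I J =>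
      extendByZero I v.1.1 i :=
    isPolynomialFunction_extendByZero (LinearMap.fst ℝ _ _ ∘ₗ l) i
  have hy (i) : IsPolynomialFunction fun v : CollisionParameters m I J =>
      extendByZero J v.1.2 i :=
    isPolynomialFunction_extendByZero (LinearMap.snd ℝ _ _ ∘ₗ l) i
  have hp (i) : IsPolynomialFunction fun v : CollisionParameters m I J => (v.2 j).1 i :=
    .linear (LinearMap.proj i ∘ₗ LinearMap.fst ℝ (Fin d → ℂ) ℝ ∘ₗ row)
  have hr : IsPolynomialFunction fun v : CollisionParameters m I J => ((v.2 j).2 : ℂ) :=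
    .linear (Complex.ofRealCLM.toLinearMap ∘ₗ LinearMap.snd ℝ (Fin d → ℂ) ℝ ∘ₗ row)
  by_cases hS : j ∈ S
  · simp only [collisionMap, hS, if_true, orthogonalRow]
    refine Fin.lastCases ?_ (fun i => ?_) c
    · simpa only [Fin.snoc_last] using hp i₀
    · simp only [Fin.snoc_castSucc]
      split_ifs
      · exact (IsPolynomialFunction.sum _ fun k _ => (hp k).mul ((hx k).sub (hy k)).star).neg
      · exact (hp i).mul ((hx i₀).sub (hy i₀)).star
  · simp only [collisionMap, hS, if_false, transverseRow]
    refine Fin.lastCases ?_ (fun i => ?_) c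
    · simp only [Fin.snoc_last]
      refine .mul (.sub (.mul (hr.mul (.const _)) ?_) ?_) (.const _)
      · exact .sum _ fun k _ => (hp k).mul ((hx k).sub (hy k)).star
      · exact .sum _ fun k _ => (hp k).mul ((hx k).add (hy k)).star
    · simpa only [Fin.snoc_castSucc] using hp i

/-- Every collision of two distinct vectors is of the parametrized form. -/
theorem exists_mem_range_collisionMap {m d : ℕ} {u : Fin m × Fin (d + 1) → ℂ}
    {I J : Finset (Fin d)} {ξ : I → ℂ} {η : J → ℂ}
    (h : affineMagnitudes (linearPart u) (shiftPart u) (extendByZero I ξ) =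
      affineMagnitudes (linearPart u) (shiftPart u) (extendByZero J η))
    (hne : extendByZero I ξ ≠ extendByZero J η) :
    ∃ (i₀ : Fin d) (S : Set (Fin m)), u ∈ Set.range (collisionMap I J i₀ S) := by
  obtain ⟨i₀, hi⟩ := Function.ne_iff.1 hne
  set x := extendByZero I ξ with hx
  set y := extendByZero J η with hy
  let S : Set (Fin m) := {j | linearPart u j ⬝ᵥ star (x - y) = 0}
  have hrow (j : Fin m) : (fun c => u (j, c)) =
      Fin.snoc (α := fun _ => ℂ) (linearPart u j) (shiftPart u j) := by
    ext c
    refine Fin.lastCases ?_ (fun i => ?_) c <;> simp [linearPart, shiftPart]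
  have hpar (j : Fin m) : ∃ q : (Fin d → ℂ) × ℝ,
      (j ∈ S → orthogonalRow i₀ x y q.1 = fun c => u (j, c)) ∧
        (j ∉ S → transverseRow x y q.1 q.2 = fun c => u (j, c)) := by
    rw [hrow]
    by_cases hj : j ∈ S
    · obtain ⟨p, hp⟩ := exists_orthogonalRow (shiftPart u j) hi hj
      exact ⟨(p, 0), fun _ => hp, fun h => absurd hj h⟩
    · obtain ⟨r, hr⟩ := exists_transverseRow (congrFun h j) hj
      exact ⟨(linearPart u j, r), fun h => absurd h hj, fun _ => hr⟩
  choose q hq using hpar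
  refine ⟨i₀, S, ((ξ, η), q), ?_⟩
  ext ⟨j, c⟩
  simp only [collisionMap, ← hx, ← hy]
  split_ifs with hj
  · rw [(hq j).1 hj]
  · rw [(hq j).2 hj]

theorem mainTheorem8 (m d s : ℕ) (hm : 4 * s + 1 ≤ m) :
    HoldsGenerically fun u : Fin m × Fin (d + 1) → ℂ =>
      IsSparseAffinePhaseRetrievable s (linearPart u) (shiftPart u) := by
  have key : HoldsGenerically fun u : Fin m × Fin (d + 1) → ℂ =>
      ∀ t : {I : Finset (Fin d) // I.card ≤ s} × {J : Finset (Fin d) // J.card ≤ s} ×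
        Fin d × Set (Fin m), u ∉ Set.range (collisionMap t.1.1 t.2.1.1 t.2.2.1 t.2.2.2) := by
    refine holdsGenerically_forall fun t =>
      holdsGenerically_notMem_range (isPolynomialFunction_collisionMap _ _ _ _) ?_
    -- Each of the `m ≥ 4s + 1` rows loses one of its `2d + 2` real dimensions, while the vectors
    -- `x` and `y` contribute at most `4s` in total.
    have hI := t.1.2
    have hJ := t.2.1.2
    rw [finrank_collisionParameters, Fintype.card_prod, Fintype.card_fin, Fintype.card_fin]
    linarith
  refine key.mono fun u hu x hx y hy hxy => ?_
  by_contra hne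
  obtain ⟨I, hI, ξ, rfl⟩ := exists_extendByZero_of_mem_sparseVectors hx
  obtain ⟨J, hJ, η, rfl⟩ := exists_extendByZero_of_mem_sparseVectors hy
  obtain ⟨i₀, S, hS⟩ := exists_mem_range_collisionMap hxy hne
  exact hu (⟨I, hI⟩, ⟨J, hJ⟩, i₀, S) hS
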